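/- Let $N\ge 1$, let $V=(V(i,j))$ be a real symmetric positive definite $N\times N$ matrix, fix $n\in\{1,\dots,N\}$, $\alpha>0$ and $\sigma>0$, and let $w$ be a standard one-dimensional Brownian motion. On $L=\mathbb R^{2N}$, with points $\psi=(q,p)$, $q,p\in\mathbb R^N$, and the standard Euclidean scalar product, put $H(\psi)=\frac12\sum_{i=1}^N p_i^2+\frac12\sum_{i,j=1}^N V(i,j)q_iq_j$, $A(q,p)=(p,\,-Vq-\alpha p_n e_n)$ and $g_n=(0,e_n)$, where $e_n$ is the $n$-th standard basis vector of $\mathbb R^N$. Let $\psi(t)$, $t\ge0$, be the solution of $$d\psi=A\psi\,dt+\sigma g_n\,dw_t$$ with a deterministic initial vector $\psi(0)\in L$. Let $L_-=\{\psi\in L:\ H(e^{tA}\psi)\to0 \text{ as } t\to+\infty\}$, which is a linear subspace of $L$, and let $\psi^{(-)}(t)$ be the component of $\psi(t)$ in $L_-$ with respect to the decomposition of $L$ into $L_-$ and its orthogonal complement. Then, for every $\psi(0)\in L$, $\psi^{(-)}(t)$ converges in distribution, as $t\to+\infty$, to a random vector $\xi$ with values in $L_-$ whose distribution is absolutely continuous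 with respect to the Lebesgue measure on $L_-$ (defined by the induced Euclidean structure), with density $$p_\xi(\psi)=\frac1Z\exp\Big(-\frac{2\alpha}{\sigma^2}H(\psi)\Big),\qquad \psi\in L_-,$$ where $Z\in(0,\infty)$ is the normalizing constant. Moreover, $\mathbf E\,H(\psi^{(-)}(t))$ is finite for every $t\ge0$, and $$\lim_{t\to+\infty}\mathbf E\,H(\psi^{(-)}(t))=\frac{\sigma^2}{4\alpha}\dim L_-.$$ -/

import Mathlib

open MeasureTheory ProbabilityTheory Filter
open scoped Topology NNReal

noncomputable section

namespace DissipativeHamiltonian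

/-- The phase space `ℝ^{2N}` of points `ψ = (q, p)` with its Euclidean scalar product:
`ψ (Sum.inl k)` is the coordinate `q_k` and `ψ (Sum.inr k)` is the momentum `p_k`. -/
abbrev Phase (N : ℕ) : Type := EuclideanSpace ℝ (Fin N ⊕ Fin N)

/-- The quadratic Hamiltonian `H(q, p) = ½ ∑ p_i² + ½ ∑ V(i,j) q_i q_j`. -/
def energy {N : ℕ} (V : Matrix (Fin N) (Fin N) ℝ) (ψ : Phase N) : ℝ :=
  (1 / 2) * ∑ i, ψ (Sum.inr i) ^ 2
    + (1 / 2) * ∑ i, ∑ j, V i j * ψ (Sum.inl i) * ψ (Sum.inl j)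

/-- The drift `A = (0, E; -V, -D)`, where `D` has the only nonzero entry `α`, at place `(n, n)`;
that is, `A (q, p) = (p, -V q - α p_n e_n)`. -/
def drift {N : ℕ} (V : Matrix (Fin N) (Fin N) ℝ) (α : ℝ) (n : Fin N) : Phase N →L[ℝ] Phase N :=
  Matrix.toEuclideanCLM (𝕜 := ℝ)
    (Matrix.fromBlocks 0 1 (-V) (-(α • Matrix.single n n (1 : ℝ))))

/-- The direction `g_n = (0, e_n)` of the noise. -/
def noiseDir {N : ℕ} (n : Fin N) : Phase N := EuclideanSpace.single (Sum.inr n) 1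

/-- `e^{tA} ψ`. -/
def flow {N : ℕ} (V : Matrix (Fin N) (Fin N) ℝ) (α : ℝ) (n : Fin N) (t : ℝ) (ψ : Phase N) :
    Phase N :=
  NormedSpace.exp (t • drift V α n) ψ

/-- `ψ` is a solution, for times `t ≥ 0`, of `dψ = A ψ dt + σ g_n dw` with `ψ(0) = ψ₀`.
As the noise is additive, the stochastic equation is a pathwise integral equation:
`ψ(t) = ψ₀ + ∫₀ᵗ A ψ(s) ds + σ w(t) g_n` for all `t ≥ 0`, almost surely. -/
structure IsSolution {N : ℕ} {Ω : Type*} [MeasurableSpace Ω] (P : Measure Ω)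
    (V : Matrix (Fin N) (Fin N) ℝ) (α σ : ℝ) (n : Fin N) (w : ℝ≥0 → Ω → ℝ)
    (ψ₀ : Phase N) (ψ : ℝ≥0 → Ω → Phase N) : Prop where
  aemeasurable : ∀ t, AEMeasurable (ψ t) P
  continuous_paths : ∀ᵐ ω ∂P, Continuous fun t => ψ t ω
  equation : ∀ᵐ ω ∂P, ∀ t : ℝ≥0,
    ψ t ω = ψ₀ + (∫ s in (0 : ℝ)..t, drift V α n (ψ s.toNNReal ω)) + (σ * w t ω) • noiseDir n

theorem energy_nonneg {N : ℕ} {V : Matrix (Fin N) (Fin N) ℝ} (hV : V.PosDef) (ψ : Phase N) :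
    0 ≤ energy V ψ := by
  have h := hV.posSemidef.dotProduct_mulVec_nonneg (fun i => ψ (Sum.inl i))
  have e : ∑ i, ∑ j, V i j * ψ (Sum.inl i) * ψ (Sum.inl j)
      = star (fun i => ψ (Sum.inl i)) ⬝ᵥ V.mulVec (fun i => ψ (Sum.inl i)) := by
    simp only [dotProduct, Matrix.mulVec, Finset.mul_sum, star_trivial]
    refine Finset.sum_congr rfl fun i _ => Finset.sum_congr rfl fun j _ => ?_
    ring
  have : 0 ≤ ∑ i, ψ (Sum.inr i) ^ 2 := Finset.sum_nonneg fun i _ => sq_nonneg _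
  unfold energy
  rw [e]
  positivity

theorem energy_smul {N : ℕ} (V : Matrix (Fin N) (Fin N) ℝ) (c : ℝ) (ψ : Phase N) :
    energy V (c • ψ) = c ^ 2 * energy V ψ := by
  simp only [energy, PiLp.smul_apply, smul_eq_mul, mul_add, Finset.mul_sum]
  congr 1
  · exact Finset.sum_congr rfl fun i _ => by ring
  · exact Finset.sum_congr rfl fun i _ => Finset.sum_congr rfl fun j _ => by ring

theorem energy_parallelogram {N : ℕ} (V : Matrix (Fin N) (Fin N) ℝ) (x y : Phase N) :
    energy V (x + y) + energy V (x - y) = 2 * energy V x + 2 * energy V y := by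
  simp only [energy, PiLp.add_apply, PiLp.sub_apply, mul_add, Finset.mul_sum]
  have h1 : ∀ a b c d e f g h : ℝ, a + c = e + g → b + d = f + h →
      a + b + (c + d) = e + f + (g + h) := by intros; linarith
  apply h1 <;> simp only [← Finset.sum_add_distrib]
  · exact Finset.sum_congr rfl fun i _ => by ring
  · exact Finset.sum_congr rfl fun i _ => Finset.sum_congr rfl fun j _ => by ring

/-- The subspace `L₋ = {ψ : H(e^{tA} ψ) → 0 as t → ∞}`. -/
def LMinus {N : ℕ} (V : Matrix (Fin N) (Fin N) ℝ) (hV : V.PosDef) (α : ℝ) (n : Fin N) :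
    Submodule ℝ (Phase N) where
  carrier := {ψ | Tendsto (fun t : ℝ => energy V (flow V α n t ψ)) atTop (𝓝 0)}
  zero_mem' := by simp [flow, energy]
  add_mem' := by
    intro x y hx hy
    have hx' : Tendsto (fun t : ℝ => energy V (flow V α n t x)) atTop (𝓝 0) := hx
    have hy' : Tendsto (fun t : ℝ => energy V (flow V α n t y)) atTop (𝓝 0) := hy
    have hs := (hx'.const_mul 2).add (hy'.const_mul 2)
    simp only [mul_zero, add_zero] at hs
    refine squeeze_zero (fun t => energy_nonneg hV _) (fun t => ?_) hs
    have h := energy_parallelogram V (flow V α n t x) (flow V α n t y)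
    have h0 := energy_nonneg hV (flow V α n t x - flow V α n t y)
    have e : flow V α n t (x + y) = flow V α n t x + flow V α n t y := by simp [flow]
    rw [e]
    linarith
  smul_mem' := by
    intro c x hx
    have hx' : Tendsto (fun t : ℝ => energy V (flow V α n t x)) atTop (𝓝 0) := hx
    have e : ∀ t, energy V (flow V α n t (c • x)) = c ^ 2 * energy V (flow V α n t x) := by
      intro t
      rw [← energy_smul]
      simp [flow]
    change Tendsto (fun t : ℝ => energy V (flow V α n t (c • x))) atTop (𝓝 0)
    simp only [e]
    simpa using hx'.const_mul (c ^ 2)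

/-- The Lebesgue measure of a subspace `S` defined by the Euclidean structure induced on `S`:
the Haar measure which gives mass one to the cube spanned by an orthonormal basis of `S`.
(It is not the restriction to `S` of the Lebesgue measure of the whole space.) -/
def lebesgue {N : ℕ} (S : Submodule ℝ (Phase N)) : Measure S :=
  (stdOrthonormalBasis ℝ S).toBasis.addHaar

/-- The measure on `L₋` with density `Z⁻¹ exp(-(2α/σ²) H)` with respect to the Lebesgue measure. -/
def gibbs {N : ℕ} (V : Matrix (Fin N) (Fin N) ℝ) (hV : V.PosDef) (α σ : ℝ) (n : Fin N) (Z : ℝ) :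
    Measure (LMinus V hV α n) :=
  (lebesgue (LMinus V hV α n)).withDensity fun ψ =>
    ENNReal.ofReal (1 / Z * Real.exp (-(2 * α / σ ^ 2) * energy V (ψ : Phase N)))

/-- The component `ψ⁽⁻⁾` in `L₋` of a vector `ψ`, in the decomposition of the phase space into `L₋`
and its orthogonal complement. -/
def minusPart {N : ℕ} (V : Matrix (Fin N) (Fin N) ℝ) (hV : V.PosDef) (α : ℝ) (n : Fin N)
    (ψ : Phase N) : LMinus V hV α n :=
  (LMinus V hV α n).orthogonalProjectionOnto ψ

end DissipativeHamiltonian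

end

/-!
The noise direction `g_n` and the whole dissipation live in `L₋`, and there the equation is a stable
linear equation with Gaussian solution, so only means and variances are needed.

**The subspace.** `L₋` is the orthogonal complement of the space `undamped V n` of states which never
feel the friction (`LMinus_eq_orthogonal`). On the undamped space the energy is conserved; on its
complement it tends to `0` by LaSalle's invariance principle (`tendsto_energy_flow_zero`). Both spaces
are invariant under the flow.

**The law.** The solution is `e^{tA} ψ₀ + σ ∫₀ᵗ e^{(t-s)A} g_n dw_s`, and its linear functionals are
Gaussian with variance `σ² ∫₀ᵗ ⟪u, e^{sA} g_n⟫² ds` (`hasLaw_inner_of_integral_equation`). As the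
integrand is smooth, the stochastic integral is defined pathwise by integration by parts, and its law
is read off from Riemann–Stieltjes sums (`hasLaw_wienerIntegral`).

**The variance.** Let `C` be the Hessian of `H` and `R (q, p) = (q, -p)`. For the form `⟪C x, y⟫` the
adjoint of `e^{sA}` is `R e^{sA} R`, hence `⟪C b, e^{sA} g_n⟫ = -p_n (e^{sA} R b)`. As
`d/ds H (e^{sA} x) = -α p_n (e^{sA} x) ^ 2`, the variance of `⟪C b, ψ(t)⟫` is
`(σ² / α) (H b - H (e^{tA} R b))`, which tends to `(σ² / α) H b` for `b ∈ L₋` (`tendsto_variance`);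
the means tend to `0` (`tendsto_inner_flow_zero`).

**Conclusion.** Every functional on `L₋` has the form `⟪C b, ·⟫` with `b ∈ L₋`, so the characteristic
functions of `ψ⁽⁻⁾(t)` converge; the limit is that of the Gibbs measure
(`exists_isProbabilityMeasure_gibbs`), and Lévy's continuity theorem gives convergence in
distribution. In coordinates that are orthonormal for `⟪C x, y⟫`, each of the `dim L₋` squared
coordinates contributes `σ² / (4 α)` to the limit of the mean energy.
-/

namespace DissipativeHamiltonian

open scoped Matrix

/-! ### The Wiener integral of a smooth function -/

/-- Riemann–Stieltjes sums of a `C¹` integrand `φ` against a merely continuous `w` converge, the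
limit being given by integration by parts. -/
theorem tendsto_sum_mul_increments {φ φ' w : ℝ → ℝ} {t : ℝ} (ht : 0 ≤ t)
    (hφ : ∀ s, HasDerivAt φ (φ' s) s) (hφ' : Continuous φ') (hw : Continuous w) :
    Tendsto (fun m : ℕ => ∑ i ∈ Finset.range m, φ ((i + 1 : ℕ) * (t / m)) *
        (w ((i + 1 : ℕ) * (t / m)) - w (i * (t / m)))) atTop
      (𝓝 (φ t * w t - φ 0 * w 0 - ∫ s in (0 : ℝ)..t, φ' s * w s)) := by
  obtain ⟨M, hM⟩ := (isCompact_Icc (a := 0) (b := t)).exists_bound_of_continuousOn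
    hφ'.continuousOn
  have huc := (isCompact_Icc (a := 0) (b := t)).uniformContinuousOn_of_continuous hw.continuousOn
  rw [Metric.uniformContinuousOn_iff] at huc
  have hM0 : 0 ≤ M := (norm_nonneg _).trans (hM 0 ⟨le_rfl, ht⟩)
  rw [Metric.tendsto_atTop]
  intro ε hε
  obtain ⟨δ, hδ, hδw⟩ := huc (ε / (t * M + 1)) (by positivity)
  obtain ⟨m₀, hm₀⟩ := exists_nat_gt (t / δ)
  refine ⟨m₀ + 1, fun m hm => ?_⟩
  have hmpos : (0 : ℝ) < m := by exact_mod_cast (by omega : 0 < m)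
  have hmδ : t / m < δ := by
    rw [div_lt_comm₀ hmpos hδ]
    exact hm₀.trans (by exact_mod_cast (by omega : m₀ < m))
  set h : ℝ := t / m with hh
  have h0 : 0 ≤ h := by positivity
  have hmh : (m : ℝ) * h = t := by rw [hh]; field_simp
  have int1 : ∀ a b, IntervalIntegrable (fun s => φ' s * w s) volume a b := fun a b =>
    (hφ'.mul hw).intervalIntegrable _ _
  have tel := Finset.sum_range_sub (fun i : ℕ => φ (i * h) * w (i * h)) m
  have hint := intervalIntegral.sum_integral_adjacent_intervals (μ := volume)
    (f := fun s => φ' s * w s) (a := fun i : ℕ => (i : ℝ) * h) (n := m) (fun k _ => int1 _ _)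
  simp only [Nat.cast_zero, zero_mul, hmh] at tel hint
  have hftc : ∀ i : ℕ, φ ((i + 1 : ℕ) * h) - φ (i * h) =
      ∫ s in (i * h)..((i + 1 : ℕ) * h), φ' s := fun i =>
    (intervalIntegral.integral_eq_sub_of_hasDerivAt (fun s _ => hφ s)
      (hφ'.intervalIntegrable _ _)).symm
  -- summation by parts turns the error into integrals of the oscillation of `w` on small intervals
  have key : (∑ i ∈ Finset.range m, φ ((i + 1 : ℕ) * h) *
        (w ((i + 1 : ℕ) * h) - w (i * h))) -
      (φ t * w t - φ 0 * w 0 - ∫ s in (0 : ℝ)..t, φ' s * w s) =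
      ∑ i ∈ Finset.range m, ∫ s in (i * h)..((i + 1 : ℕ) * h), φ' s * (w s - w (i * h)) := by
    rw [← tel, ← hint, ← Finset.sum_sub_distrib, ← Finset.sum_sub_distrib]
    refine Finset.sum_congr rfl fun i _ => ?_
    simp only [mul_sub]
    have int2 : IntervalIntegrable (fun s => φ' s * w (i * h)) volume (i * h) ((i + 1 : ℕ) * h) :=
      (hφ'.mul continuous_const).intervalIntegrable _ _
    rw [intervalIntegral.integral_sub (int1 _ _) int2, intervalIntegral.integral_mul_const, ← hftc]
    ring
  rw [Real.dist_eq, key]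
  have bound : ∀ i ∈ Finset.range m,
      ‖∫ s in (i * h)..((i + 1 : ℕ) * h), φ' s * (w s - w (i * h))‖ ≤
        M * (ε / (t * M + 1)) * h := by
    intro i hi
    have hi' : ((i + 1 : ℕ) : ℝ) ≤ m := by exact_mod_cast Finset.mem_range.mp hi
    have hle : (i : ℝ) * h ≤ (i + 1 : ℕ) * h := by push_cast; nlinarith
    have hup : ((i + 1 : ℕ) : ℝ) * h ≤ t := hmh ▸ mul_le_mul_of_nonneg_right hi' h0
    have hlo : 0 ≤ (i : ℝ) * h := by positivity
    have := intervalIntegral.norm_integral_le_of_norm_le_const (a := i * h)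
      (b := (i + 1 : ℕ) * h) (f := fun s => φ' s * (w s - w (i * h)))
      (C := M * (ε / (t * M + 1))) (fun s hs => ?_)
    · refine this.trans_eq ?_
      rw [abs_of_nonneg (by linarith)]
      push_cast; ring
    · rw [Set.uIoc_of_le hle] at hs
      rw [norm_mul]
      refine mul_le_mul (hM s ⟨hlo.trans hs.1.le, hs.2.trans hup⟩) ?_ (norm_nonneg _) hM0
      rw [← dist_eq_norm]
      refine (hδw s ⟨hlo.trans hs.1.le, hs.2.trans hup⟩ _ ⟨hlo, hle.trans hup⟩ ?_).le
      rw [Real.dist_eq, abs_of_nonneg (by linarith [hs.1])]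
      have := hs.2
      push_cast at this
      linarith
  calc _ ≤ ∑ i ∈ Finset.range m, M * (ε / (t * M + 1)) * h := norm_sum_le_of_le _ bound
    _ = t * M * (ε / (t * M + 1)) := by
      rw [Finset.sum_const, Finset.card_range, nsmul_eq_mul, ← hmh]; ring
    _ < ε := by
      rw [mul_div_assoc', div_lt_iff₀ (by positivity)]
      nlinarith [mul_nonneg ht hM0]

/-- The sums of `tendsto_sum_mul_increments` for `φ ^ 2` against the identity are ordinary
Riemann sums. -/
theorem tendsto_riemannSum_sq {φ φ' : ℝ → ℝ} {t : ℝ} (ht : 0 ≤ t)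
    (hφ : ∀ s, HasDerivAt φ (φ' s) s) (hφ' : Continuous φ') :
    Tendsto (fun m : ℕ => ∑ i ∈ Finset.range m, φ ((i + 1 : ℕ) * (t / m)) ^ 2 * (t / m)) atTop
      (𝓝 (∫ s in (0 : ℝ)..t, φ s ^ 2)) := by
  have hc : Continuous φ := continuous_iff_continuousAt.2 fun s => (hφ s).continuousAt
  have hsq : ∀ s, HasDerivAt (fun s => φ s ^ 2) (2 * φ s * φ' s) s := fun s => by
    simpa using (hφ s).fun_pow 2
  have h := tendsto_sum_mul_increments ht hsq (by fun_prop) continuous_id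
  -- integration by parts, the boundary term at `0` being `0`
  have e : φ t ^ 2 * id t - φ 0 ^ 2 * id 0 - ∫ s in (0 : ℝ)..t, 2 * φ s * φ' s * id s =
      ∫ s in (0 : ℝ)..t, φ s ^ 2 := by
    have hp := intervalIntegral.integral_mul_deriv_eq_deriv_mul (a := 0) (b := t)
      (fun s _ => hsq s) (fun s _ => hasDerivAt_id s)
      (Continuous.intervalIntegrable (by fun_prop) _ _)
      (Continuous.intervalIntegrable (by fun_prop) _ _)
    simp only [mul_one] at hp
    exact hp.symm
  rw [e] at h
  refine h.congr fun m => Finset.sum_congr rfl fun i _ => ?_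
  simp only [id]
  push_cast
  ring

/-- The Wiener integral `∫₀ᵗ φ dw` of a `C¹` function, written pathwise by integration by parts, is
centred Gaussian with variance `∫₀ᵗ φ²`: it is the almost sure limit of sums of independent centred
Gaussian variables, so its characteristic function is the limit of theirs. -/
theorem hasLaw_wienerIntegral {Ω : Type*} [MeasurableSpace Ω] {P : Measure Ω}
    [IsProbabilityMeasure P] {w : ℝ≥0 → Ω → ℝ} (hw : IsBrownianReal w P) {φ φ' : ℝ → ℝ}
    (hφ : ∀ s, HasDerivAt φ (φ' s) s) (hφ' : Continuous φ') (t : ℝ≥0) :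
    HasLaw (fun ω => φ t * w t ω - ∫ s in (0 : ℝ)..t, φ' s * w s.toNNReal ω)
      (gaussianReal 0 (∫ s in (0 : ℝ)..t, φ s ^ 2).toNNReal) P := by
  have ht : (0 : ℝ) ≤ t := t.2
  set X : Ω → ℝ := fun ω => φ t * w t ω - ∫ s in (0 : ℝ)..t, φ' s * w s.toNNReal ω
  let τ : ℕ → ℕ → ℝ≥0 := fun m i => i * (t / m)
  let c : ℕ → ℕ → ℝ := fun m i => φ ((i + 1 : ℕ) * (t / m : ℝ))
  let Y : ℕ → ℕ → Ω → ℝ := fun m i ω => c m i * (w (τ m (i + 1)) ω - w (τ m i) ω)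
  have hYm : ∀ m i, AEMeasurable (Y m i) P := fun m i =>
    ((hw.aemeasurable _).sub (hw.aemeasurable _)).const_mul _
  have hSm : ∀ m, AEMeasurable (fun ω => ∑ i ∈ Finset.range m, Y m i ω) P := fun m =>
    Finset.aemeasurable_fun_sum _ fun i _ => hYm m i
  have hlim : ∀ᵐ ω ∂P, Tendsto (fun m => ∑ i ∈ Finset.range m, Y m i ω) atTop (𝓝 (X ω)) := by
    filter_upwards [hw.cont, hw.eval_zero_ae_eq_zero] with ω hc h0
    have := tendsto_sum_mul_increments ht hφ hφ' (hc.comp continuous_real_toNNReal)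
    simp only [Function.comp_def, Real.toNNReal_zero, h0, mul_zero, sub_zero,
      Real.toNNReal_coe] at this
    refine this.congr fun m => Finset.sum_congr rfl fun i _ => ?_
    have e : ∀ j : ℕ, ((j : ℝ) * ((t : ℝ) / m)).toNNReal = τ m j := fun j => by
      rw [← Real.toNNReal_coe (r := τ m j)]; simp [τ]
    simp only [Y, c, e]
  have hX : AEMeasurable X P := aemeasurable_of_tendsto_metrizable_ae _ hSm hlim
  refine ⟨hX, ?_⟩
  have : IsProbabilityMeasure (P.map X) := Measure.isProbabilityMeasure_map hX
  refine Measure.ext_of_charFun (funext fun ξ => ?_)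
  have hY : ∀ m i, charFun (P.map (Y m i)) ξ =
      Complex.exp (((-(c m i ^ 2 * (t / m)) * ξ ^ 2 / 2 : ℝ) : ℂ)) := by
    intro m i
    have hl := gaussianReal_const_mul (hw.hasLaw_sub (τ m (i + 1)) (τ m i)) (c m i)
    have hm : P.map (Y m i) = _ := hl.map_eq
    rw [hm, charFun_gaussianReal]
    congr 1
    have hd : ((nndist (τ m (i + 1)).1 (τ m i).1 : ℝ≥0) : ℝ) = t / m := by
      rw [coe_nndist, Real.dist_eq]
      have : ((τ m (i + 1)).1 - (τ m i).1 : ℝ) = t / m := by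
        simp only [τ, NNReal.val_eq_coe]; push_cast; ring
      rw [this, abs_of_nonneg (by positivity)]
    simp only [NNReal.coe_mul, NNReal.coe_mk, hd]
    push_cast
    ring
  have hcf : ∀ m, charFun (P.map (fun ω => ∑ i ∈ Finset.range m, Y m i ω)) ξ =
      Complex.exp (((-(∑ i ∈ Finset.range m, c m i ^ 2 * (t / m)) * ξ ^ 2 / 2 : ℝ) : ℂ)) := by
    intro m
    have hmono : Monotone (τ m) := fun a b hab => by
      simp only [τ]; gcongr
    have hind : iIndepFun (Y m) P :=
      (hw.hasIndepIncrements.nat hmono).comp (fun i x => c m i * x) (fun i => by fun_prop)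
    have hind' : iIndepFun ((Finset.range m).restrict (Y m)) P :=
      hind.precomp (g := fun i : Finset.range m => (i : ℕ)) Subtype.val_injective
    rw [iIndepFun.charFun_map_fun_finsetSum_eq_prod (fun i _ => hYm m i) hind']
    simp only [Finset.prod_apply, hY]
    rw [← Complex.exp_sum]
    congr 1
    push_cast
    rw [← Finset.sum_neg_distrib, Finset.sum_mul, Finset.sum_div]
  have h1 : Tendsto (fun m => charFun (P.map (fun ω => ∑ i ∈ Finset.range m, Y m i ω)) ξ) atTop
      (𝓝 (charFun (P.map X) ξ)) := by
    simp only [charFun_apply_real]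
    rw [integral_map hX (by fun_prop)]
    have e : ∀ m, ∫ x, Complex.exp (ξ * x * Complex.I)
        ∂(P.map (fun ω => ∑ i ∈ Finset.range m, Y m i ω)) =
        ∫ ω, Complex.exp (ξ * (∑ i ∈ Finset.range m, Y m i ω : ℝ) * Complex.I) ∂P := fun m =>
      integral_map (hSm m) (by fun_prop)
    simp only [e]
    refine tendsto_integral_of_dominated_convergence (fun _ => (1 : ℝ)) (fun m => ?_)
      (integrable_const _) (fun m => ?_) ?_
    · exact (Complex.measurable_exp.comp_aemeasurable
        (((Complex.measurable_ofReal.comp_aemeasurable (hSm m)).const_mul _).mul_const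
          _)).aestronglyMeasurable
    · refine ae_of_all _ fun ω => ?_
      rw [← Complex.ofReal_mul, Complex.norm_exp_ofReal_mul_I]
    · filter_upwards [hlim] with ω hω
      exact (((by fun_prop : Continuous fun x : ℝ =>
        Complex.exp (ξ * (x : ℂ) * Complex.I)).tendsto _).comp hω)
  have h2 : Tendsto (fun m => charFun (P.map (fun ω => ∑ i ∈ Finset.range m, Y m i ω)) ξ) atTop
      (𝓝 (Complex.exp ((-(∫ s in (0 : ℝ)..t, φ s ^ 2) * ξ ^ 2 / 2 : ℝ) : ℂ))) := by
    simp only [hcf]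
    exact (((by fun_prop : Continuous fun x : ℝ =>
        Complex.exp ((-x * ξ ^ 2 / 2 : ℝ) : ℂ)).tendsto _).comp (tendsto_riemannSum_sq ht hφ hφ'))
  rw [tendsto_nhds_unique h1 h2, charFun_gaussianReal, Real.coe_toNNReal _
    (intervalIntegral.integral_nonneg ht fun s _ => sq_nonneg _)]
  congr 1
  push_cast
  ring

theorem integral_sq_of_hasLaw_gaussianReal {Ω : Type*} [MeasurableSpace Ω] {P : Measure Ω}
    {X : Ω → ℝ} {m : ℝ} {v : ℝ≥0} (hX : HasLaw X (gaussianReal m v) P) :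
    Integrable (fun ω => X ω ^ 2) P ∧ ∫ ω, X ω ^ 2 ∂P = v + m ^ 2 := by
  have : IsProbabilityMeasure P := hX.isProbabilityMeasure
  have hL : MemLp X 2 P := hX.hasGaussianLaw.memLp_two
  refine ⟨hL.integrable_sq, ?_⟩
  have h1 := variance_eq_sub hL
  rw [hX.variance_eq, variance_id_gaussianReal, hX.integral_eq, integral_id_gaussianReal] at h1
  simp only [Pi.pow_apply] at h1
  linarith

/-! ### Linear equations with additive noise -/

section LinearSDE

variable {E : Type*} [NormedAddCommGroup E] [InnerProductSpace ℝ E]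

theorem exp_zero_smul_apply (A : E →L[ℝ] E) (x : E) :
    NormedSpace.exp ((0 : ℝ) • A) x = x := by
  rw [zero_smul, NormedSpace.exp_zero]
  rfl

variable [CompleteSpace E]

theorem hasDerivAt_exp_smul_apply (A : E →L[ℝ] E) (x : E) (s : ℝ) :
    HasDerivAt (fun s : ℝ => NormedSpace.exp (s • A) x) (NormedSpace.exp (s • A) (A x)) s := by
  simpa using (hasDerivAt_exp_smul_const A s).clm_apply (hasDerivAt_const s x)

theorem hasDerivAt_exp_smul_apply' (A : E →L[ℝ] E) (x : E) (s : ℝ) :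
    HasDerivAt (fun s : ℝ => NormedSpace.exp (s • A) x) (A (NormedSpace.exp (s • A) x)) s := by
  simpa using (hasDerivAt_exp_smul_const' A s).clm_apply (hasDerivAt_const s x)

theorem continuous_exp_smul_apply (A : E →L[ℝ] E) (x : E) :
    Continuous (fun s : ℝ => NormedSpace.exp (s • A) x) :=
  continuous_iff_continuousAt.2 fun s => (hasDerivAt_exp_smul_apply A x s).continuousAt

theorem exp_add_smul_apply (A : E →L[ℝ] E) (s t : ℝ) (x : E) :
    NormedSpace.exp ((s + t) • A) x = NormedSpace.exp (s • A) (NormedSpace.exp (t • A) x) := by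
  let := NormedAlgebra.restrictScalars ℚ ℝ (E →L[ℝ] E)
  rw [add_smul, NormedSpace.exp_add_of_commute]
  · rfl
  · exact ((Commute.refl A).smul_left s).smul_right t

/-- Variation of constants, tested against a vector `u` and written without a stochastic integral:
`⟪u, x(t)⟫ = ⟪u, e^{tA} x₀⟫ + φ(t) w(t) - ∫₀ᵗ φ'(s) w(s) ds` with `φ(s) = σ ⟪u, e^{(t-s)A} g⟫`.
The factor `e^{(t-t)A}` of `φ(t)` is left unsimplified to match `hasLaw_wienerIntegral`. -/
theorem inner_eq_of_integral_equation (A : E →L[ℝ] E) (g x₀ u : E) (σ : ℝ) {x : ℝ≥0 → E}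
    {w : ℝ≥0 → ℝ} (hx : Continuous x) (hw : Continuous w)
    (h : ∀ t : ℝ≥0, x t = x₀ + (∫ s in (0 : ℝ)..t, A (x s.toNNReal)) + (σ * w t) • g) (t : ℝ≥0) :
    inner ℝ u (x t) = inner ℝ u (NormedSpace.exp ((t : ℝ) • A) x₀) +
      (σ * inner ℝ u (NormedSpace.exp (((t : ℝ) - t) • A) g) * w t -
        ∫ s in (0 : ℝ)..t, -(σ * inner ℝ u (NormedSpace.exp (((t : ℝ) - s) • A) (A g))) *
          w s.toNNReal) := by
  -- the differentiable path `z = x - σ w g`, extended to all real times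
  set z : ℝ → E := fun s => x₀ + ∫ r in (0 : ℝ)..s, A (x r.toNNReal) with hz
  have hcont : Continuous fun r : ℝ => A (x r.toNNReal) :=
    A.continuous.comp (hx.comp continuous_real_toNNReal)
  have hzd : ∀ s, HasDerivAt z (A (x s.toNNReal)) s := fun s =>
    ((hcont.integral_hasStrictDerivAt 0 s).hasDerivAt).const_add x₀
  have hxz : ∀ s : ℝ, 0 ≤ s → x s.toNNReal = z s + (σ * w s.toNNReal) • g := fun s hs => by
    simp only [h s.toNNReal, Real.coe_toNNReal s hs, hz]
  have hexp : ∀ s : ℝ, HasDerivAt (fun s : ℝ => NormedSpace.exp (((t : ℝ) - s) • A))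
      (-(NormedSpace.exp (((t : ℝ) - s) • A) * A)) s := fun s =>
    ((hasDerivAt_exp_smul_const A ((t : ℝ) - s)).scomp s
      ((hasDerivAt_id s).const_sub (t : ℝ))).congr_deriv (by simp)
  have hF : ∀ s ∈ Set.uIcc (0 : ℝ) t,
      HasDerivAt (fun s => inner ℝ u (NormedSpace.exp (((t : ℝ) - s) • A) (z s)))
        (σ * inner ℝ u (NormedSpace.exp (((t : ℝ) - s) • A) (A g)) * w s.toNNReal) s := by
    intro s hs
    rw [Set.uIcc_of_le t.coe_nonneg] at hs
    have h1 := (hasDerivAt_const s u).inner ℝ ((hexp s).clm_apply (hzd s))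
    refine h1.congr_deriv ?_
    rw [hxz s hs.1]
    simp only [map_add, map_smul, neg_apply, mul_apply_eq_comp,
      inner_add_right, inner_neg_right, inner_smul_right, inner_zero_left]
    ring
  have hc : Continuous fun s : ℝ =>
      σ * inner ℝ u (NormedSpace.exp (((t : ℝ) - s) • A) (A g)) * w s.toNNReal := by
    have h1 : Continuous fun s : ℝ => NormedSpace.exp (((t : ℝ) - s) • A) (A g) :=
      (continuous_exp_smul_apply A (A g)).comp (by fun_prop : Continuous fun s : ℝ => (t : ℝ) - s)
    have h2 : Continuous fun s : ℝ => w s.toNNReal := hw.comp continuous_real_toNNReal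
    fun_prop
  have hint := intervalIntegral.integral_eq_sub_of_hasDerivAt hF (hc.intervalIntegrable _ _)
  have hxt := hxz t t.coe_nonneg
  rw [Real.toNNReal_coe] at hxt
  have hz0 : z 0 = x₀ := by simp [hz]
  simp only [sub_zero, hz0] at hint
  simp only [neg_mul, intervalIntegral.integral_neg, hint, hxt]
  simp [inner_add_right, inner_smul_right]
  ring

/-- Linear functionals of the solution of `dx = A x dt + σ g dw` are Gaussian, with mean
`⟪u, e^{tA} x₀⟫` and variance `σ² ∫₀ᵗ ⟪u, e^{sA} g⟫² ds`. -/
theorem hasLaw_inner_of_integral_equation {Ω : Type*} [MeasurableSpace Ω] {P : Measure Ω}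
    [IsProbabilityMeasure P] {w : ℝ≥0 → Ω → ℝ} (hw : IsBrownianReal w P) (A : E →L[ℝ] E)
    (g x₀ : E) (σ : ℝ) {x : ℝ≥0 → Ω → E} (hx : ∀ᵐ ω ∂P, Continuous fun t => x t ω)
    (h : ∀ᵐ ω ∂P, ∀ t : ℝ≥0,
      x t ω = x₀ + (∫ s in (0 : ℝ)..t, A (x s.toNNReal ω)) + (σ * w t ω) • g) (u : E) (t : ℝ≥0) :
    HasLaw (fun ω => inner ℝ u (x t ω)) (gaussianReal (inner ℝ u (NormedSpace.exp ((t : ℝ) • A) x₀))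
      (σ ^ 2 * ∫ s in (0 : ℝ)..t, inner ℝ u (NormedSpace.exp (s • A) g) ^ 2).toNNReal) P := by
  have hd : ∀ s : ℝ, HasDerivAt
      (fun s => σ * inner ℝ u (NormedSpace.exp (((t : ℝ) - s) • A) g))
      (-(σ * inner ℝ u (NormedSpace.exp (((t : ℝ) - s) • A) (A g)))) s := fun s => by
    have h1 := (hasDerivAt_exp_smul_apply A g ((t : ℝ) - s)).scomp s
      ((hasDerivAt_id s).const_sub (t : ℝ))
    have h2 := ((hasDerivAt_const s u).inner ℝ h1).const_mul σ
    refine h2.congr_deriv ?_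
    simp [inner_neg_right]
  have hc : Continuous fun s : ℝ =>
      -(σ * inner ℝ u (NormedSpace.exp (((t : ℝ) - s) • A) (A g))) := by
    have h1 : Continuous fun s : ℝ => NormedSpace.exp (((t : ℝ) - s) • A) (A g) :=
      (continuous_exp_smul_apply A (A g)).comp (by fun_prop : Continuous fun s : ℝ => (t : ℝ) - s)
    fun_prop
  have hl := gaussianReal_const_add (hasLaw_wienerIntegral hw hd hc t)
    (inner ℝ u (NormedSpace.exp ((t : ℝ) • A) x₀))
  have hv : ∫ s in (0 : ℝ)..t, (σ * inner ℝ u (NormedSpace.exp (((t : ℝ) - s) • A) g)) ^ 2 =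
      σ ^ 2 * ∫ s in (0 : ℝ)..t, inner ℝ u (NormedSpace.exp (s • A) g) ^ 2 := by
    simp only [mul_pow, intervalIntegral.integral_const_mul]
    rw [intervalIntegral.integral_comp_sub_left
      (fun s : ℝ => inner ℝ u (NormedSpace.exp (s • A) g) ^ 2)]
    simp
  rw [hv, zero_add] at hl
  refine hl.congr ?_
  filter_upwards [hx, hw.cont, h] with ω h1 h2 h3
  exact inner_eq_of_integral_equation A g x₀ u σ h1 h2 h3 t

end LinearSDE

/-! ### Energy and drift in coordinates -/

variable {N : ℕ}

/-- The positions `q` of a phase point `(q, p)`. -/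
def position (x : Phase N) : Fin N → ℝ := fun i => x (Sum.inl i)
/-- The momenta `p` of a phase point `(q, p)`. -/
def momentum (x : Phase N) : Fin N → ℝ := fun i => x (Sum.inr i)

theorem phase_ext {x y : Phase N} (hq : position x = position y) (hp : momentum x = momentum y) :
    x = y := by
  ext i
  rcases i with i | i
  · exact congrFun hq i
  · exact congrFun hp i

theorem inner_eq_dotProduct (x y : Phase N) :
    inner ℝ x y = position x ⬝ᵥ position y + momentum x ⬝ᵥ momentum y := by
  simp [PiLp.inner_apply, Fintype.sum_sum_type, dotProduct, position, momentum, mul_comm]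

/-- The Hessian `(q, p) ↦ (V q, p)` of the energy. The bilinear form `⟪hessian V x, y⟫` is the one
that polarizes twice the energy. -/
noncomputable def hessian (V : Matrix (Fin N) (Fin N) ℝ) : Phase N →L[ℝ] Phase N :=
  Matrix.toEuclideanCLM (𝕜 := ℝ) (Matrix.fromBlocks V 0 0 1)

/-- Time reversal `(q, p) ↦ (q, -p)`. -/
noncomputable def reversal : Phase N →L[ℝ] Phase N :=
  Matrix.toEuclideanCLM (𝕜 := ℝ) (Matrix.fromBlocks 1 0 0 (-1))

theorem position_toEuclideanCLM (A B C D : Matrix (Fin N) (Fin N) ℝ) (x : Phase N) :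
    position (Matrix.toEuclideanCLM (𝕜 := ℝ) (Matrix.fromBlocks A B C D) x) =
      A *ᵥ position x + B *ᵥ momentum x := by
  ext i
  simp [position, momentum, Matrix.ofLp_toEuclideanCLM, Matrix.mulVec, dotProduct,
    Fintype.sum_sum_type]

theorem momentum_toEuclideanCLM (A B C D : Matrix (Fin N) (Fin N) ℝ) (x : Phase N) :
    momentum (Matrix.toEuclideanCLM (𝕜 := ℝ) (Matrix.fromBlocks A B C D) x) =
      C *ᵥ position x + D *ᵥ momentum x := by
  ext i
  simp [position, momentum, Matrix.ofLp_toEuclideanCLM, Matrix.mulVec, dotProduct,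
    Fintype.sum_sum_type]

section
variable (V : Matrix (Fin N) (Fin N) ℝ) (α : ℝ) (n : Fin N) (x y : Phase N)

@[simp] theorem position_hessian : position (hessian V x) = V *ᵥ position x := by
  simp [hessian, position_toEuclideanCLM]
@[simp] theorem momentum_hessian : momentum (hessian V x) = momentum x := by
  simp [hessian, momentum_toEuclideanCLM]
@[simp] theorem position_reversal : position (reversal x) = position x := by
  simp [reversal, position_toEuclideanCLM]
@[simp] theorem momentum_reversal : momentum (reversal x) = -momentum x := by
  simp [reversal, momentum_toEuclideanCLM, Matrix.neg_mulVec]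
@[simp] theorem position_drift : position (drift V α n x) = momentum x := by
  simp [drift, position_toEuclideanCLM]
@[simp] theorem momentum_drift :
    momentum (drift V α n x) = -(V *ᵥ position x) - (α * momentum x n) • Pi.single n 1 := by
  rw [drift, momentum_toEuclideanCLM, Matrix.neg_mulVec, Matrix.neg_mulVec, Matrix.smul_mulVec,
    ← sub_eq_add_neg, mul_smul]
  congr 2
  ext i
  simp [Matrix.single_mulVec, Pi.single_apply, Function.update_apply]
@[simp] theorem position_noiseDir : position (noiseDir n) = 0 := by
  ext i; simp [position, noiseDir]
@[simp] theorem momentum_noiseDir : momentum (noiseDir n) = Pi.single n 1 := by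
  ext i; simp [momentum, noiseDir, Pi.single_apply]

theorem energy_eq_inner : energy V x = 1 / 2 * inner ℝ (hessian V x) x := by
  rw [inner_eq_dotProduct, position_hessian, momentum_hessian, energy, add_comm, mul_add]
  congr 2
  · simp only [dotProduct, Matrix.mulVec, Finset.sum_mul, position]
    exact Finset.sum_congr rfl fun i _ => Finset.sum_congr rfl fun j _ => by ring
  · simp [dotProduct, momentum, sq]

theorem inner_hessian_noiseDir : inner ℝ (hessian V x) (noiseDir n) = momentum x n := by
  simp [inner_eq_dotProduct]

end

variable {V : Matrix (Fin N) (Fin N) ℝ}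

theorem mulVec_dotProduct_comm (hV : V.PosDef) (a b : Fin N → ℝ) :
    (V *ᵥ a) ⬝ᵥ b = a ⬝ᵥ (V *ᵥ b) := by
  have : Vᵀ = V := by simpa using hV.isHermitian.eq
  rw [Matrix.dotProduct_mulVec, ← Matrix.mulVec_transpose, this]

theorem inner_hessian_comm (hV : V.PosDef) (x y : Phase N) :
    inner ℝ (hessian V x) y = inner ℝ x (hessian V y) := by
  simp [inner_eq_dotProduct, mulVec_dotProduct_comm hV]

/-- The Hamiltonian part of the drift does not change the energy; the friction dissipates it. -/
theorem inner_hessian_drift_self (V : Matrix (Fin N) (Fin N) ℝ) (α : ℝ) (n : Fin N) (x : Phase N) :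
    inner ℝ (hessian V x) (drift V α n x) = -α * momentum x n ^ 2 := by
  simp [inner_eq_dotProduct, dotProduct_comm (V *ᵥ position x), dotProduct_sub]
  ring

/-- With respect to the energy form, the adjoint of the drift is its conjugate by time reversal. -/
theorem inner_hessian_drift_reversal (hV : V.PosDef) (α : ℝ) (n : Fin N) (x y : Phase N) :
    inner ℝ (hessian V (drift V α n x)) (reversal y) =
      inner ℝ (hessian V x) (reversal (drift V α n y)) := by
  simp [inner_eq_dotProduct, mulVec_dotProduct_comm hV, sub_dotProduct]
  ring

theorem inner_hessian_reversal_reversal (x y : Phase N) :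
    inner ℝ (hessian V (reversal x)) (reversal y) = inner ℝ (hessian V x) y := by
  simp [inner_eq_dotProduct]

theorem eq_zero_of_energy_eq_zero (hV : V.PosDef) {x : Phase N} (h : energy V x = 0) : x = 0 := by
  rw [energy_eq_inner, inner_eq_dotProduct, position_hessian, momentum_hessian] at h
  have hq : 0 ≤ (V *ᵥ position x) ⬝ᵥ position x := by
    simpa [dotProduct_comm] using hV.posSemidef.dotProduct_mulVec_nonneg (position x)
  have hp : 0 ≤ momentum x ⬝ᵥ momentum x := by
    simpa using dotProduct_star_self_nonneg (momentum x)
  refine phase_ext ?_ ?_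
  · by_contra hne
    have := hV.dotProduct_mulVec_pos (x := position x) (fun h0 => hne (by rw [h0]; rfl))
    simp only [star_trivial, dotProduct_comm (position x)] at this
    linarith
  · have : momentum x = 0 := dotProduct_self_eq_zero.1 (by linarith)
    rw [this]; rfl

theorem continuous_energy (V : Matrix (Fin N) (Fin N) ℝ) : Continuous (energy V) := by
  unfold energy
  fun_prop

/-- The energy is coercive; the constant is its minimum on the unit sphere. -/
theorem exists_mul_norm_sq_le_energy (hV : V.PosDef) :
    ∃ c > 0, ∀ x : Phase N, c * ‖x‖ ^ 2 ≤ energy V x := by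
  -- the sphere is empty when the phase space is trivial
  rcases (Metric.sphere (0 : Phase N) 1).eq_empty_or_nonempty with he | hne
  · refine ⟨1, one_pos, fun x => ?_⟩
    have : x = 0 := by
      by_contra hx
      have : ‖x‖⁻¹ • x ∈ Metric.sphere (0 : Phase N) 1 := by
        simp [norm_smul, hx]
      simp [he] at this
    subst this
    simpa using energy_nonneg hV 0
  · obtain ⟨x₀, hx₀, hmin⟩ := (isCompact_sphere (0 : Phase N) 1).exists_isMinOn hne
      (continuous_energy V).continuousOn
    refine ⟨energy V x₀, (energy_nonneg hV x₀).lt_of_ne' fun h => ?_, fun x => ?_⟩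
    · simp [eq_zero_of_energy_eq_zero hV h] at hx₀
    · by_cases hx : x = 0
      · subst hx
        simpa using energy_nonneg hV 0
      have hn : ‖x‖ ≠ 0 := by simpa using hx
      have h1 : energy V x₀ ≤ energy V (‖x‖⁻¹ • x) :=
        hmin (show ‖x‖⁻¹ • x ∈ Metric.sphere (0 : Phase N) 1 by simp [norm_smul, hx])
      rw [energy_smul] at h1
      calc energy V x₀ * ‖x‖ ^ 2 ≤ ‖x‖⁻¹ ^ 2 * energy V x * ‖x‖ ^ 2 := by gcongr
        _ = energy V x := by field_simp

theorem tendsto_zero_of_energy_tendsto_zero (hV : V.PosDef) {β : Type*} {l : Filter β}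
    {f : β → Phase N} (h : Tendsto (fun t => energy V (f t)) l (𝓝 0)) : Tendsto f l (𝓝 0) := by
  obtain ⟨c, hc, hle⟩ := exists_mul_norm_sq_le_energy hV
  rw [tendsto_zero_iff_norm_tendsto_zero]
  have h1 : Tendsto (fun t => √(energy V (f t) / c)) l (𝓝 0) := by
    simpa using (h.div_const c).sqrt
  refine squeeze_zero (fun t => norm_nonneg _) (fun t => Real.le_sqrt_of_sq_le ?_) h1
  rw [le_div_iff₀ hc, mul_comm]
  exact hle _

/-! ### The flow and the balance of energy -/

theorem hasDerivAt_flow (V : Matrix (Fin N) (Fin N) ℝ) (α : ℝ) (n : Fin N) (x : Phase N) (s : ℝ) :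
    HasDerivAt (fun s => flow V α n s x) (drift V α n (flow V α n s x)) s :=
  hasDerivAt_exp_smul_apply' _ x s

theorem continuous_flow (V : Matrix (Fin N) (Fin N) ℝ) (α : ℝ) (n : Fin N) (x : Phase N) :
    Continuous (fun s => flow V α n s x) :=
  continuous_exp_smul_apply _ x

theorem flow_add (V : Matrix (Fin N) (Fin N) ℝ) (α : ℝ) (n : Fin N) (s t : ℝ) (x : Phase N) :
    flow V α n (s + t) x = flow V α n s (flow V α n t x) :=
  exp_add_smul_apply _ s t x

@[simp] theorem flow_zero (V : Matrix (Fin N) (Fin N) ℝ) (α : ℝ) (n : Fin N) (x : Phase N) :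
    flow V α n 0 x = x :=
  exp_zero_smul_apply _ x

theorem continuous_momentum_flow (V : Matrix (Fin N) (Fin N) ℝ) (α : ℝ) (n : Fin N)
    (x : Phase N) : Continuous (fun s => momentum (flow V α n s x) n) := by
  have := continuous_flow V α n x
  unfold momentum
  fun_prop

theorem hasDerivAt_energy_flow (hV : V.PosDef) (α : ℝ) (n : Fin N) (x : Phase N) (s : ℝ) :
    HasDerivAt (fun s => energy V (flow V α n s x)) (-α * momentum (flow V α n s x) n ^ 2) s := by
  have h := hasDerivAt_flow V α n x s
  have h1 := (((hessian V).hasFDerivAt.comp_hasDerivAt s h).inner ℝ h).const_mul (1 / 2 : ℝ)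
  simp only [energy_eq_inner]
  refine h1.congr_deriv ?_
  simp only [Function.comp_apply]
  rw [inner_hessian_comm hV (drift V α n _), real_inner_comm (hessian V _) (drift V α n _),
    inner_hessian_drift_self]
  ring

/-- Energy balance: the energy lost up to time `t` is the work of the friction on `p_n`. -/
theorem integral_momentum_flow_sq (hV : V.PosDef) (α : ℝ) (n : Fin N) (x : Phase N) (t : ℝ) :
    α * ∫ s in (0 : ℝ)..t, momentum (flow V α n s x) n ^ 2 =
      energy V x - energy V (flow V α n t x) := by
  have h := intervalIntegral.integral_eq_sub_of_hasDerivAt (a := 0) (b := t)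
    (fun s _ => hasDerivAt_energy_flow hV α n x s)
    ((((continuous_momentum_flow V α n x).pow 2).const_mul _).intervalIntegrable _ _)
  simp only [intervalIntegral.integral_const_mul, flow_zero] at h
  linarith

theorem antitone_energy_flow (hV : V.PosDef) {α : ℝ} (hα : 0 ≤ α) (n : Fin N) (x : Phase N) :
    Antitone (fun s => energy V (flow V α n s x)) :=
  antitone_of_hasDerivAt_nonpos (fun s => hasDerivAt_energy_flow hV α n x s) fun s => by
    simp only [Pi.zero_apply]; nlinarith [sq_nonneg (momentum (flow V α n s x) n)]

/-! ### The undamped subspace and `L₋` -/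

theorem exp_smul_apply_mem {E : Type*} [NormedAddCommGroup E] [InnerProductSpace ℝ E]
    [CompleteSpace E] {W : Submodule ℝ E} (hW : IsClosed (W : Set E)) {A : E →L[ℝ] E}
    (hA : ∀ x ∈ W, A x ∈ W) (t : ℝ) {x : E} (hx : x ∈ W) : NormedSpace.exp (t • A) x ∈ W := by
  have hs := (NormedSpace.exp_series_hasSum_exp' (𝕂 := ℝ) (t • A)).mapL
    (ContinuousLinearMap.apply ℝ E x)
  refine hW.mem_of_tendsto hs (Eventually.of_forall fun s => W.sum_mem fun k _ => ?_)
  have hk : ∀ k : ℕ, ((t • A) ^ k) x ∈ W := fun k => by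
    induction k with
    | zero => simpa using hx
    | succ k ih =>
      rw [pow_succ']
      exact W.smul_mem t (hA _ ih)
  exact W.smul_mem _ (hk k)

/-- The phase points with `(V^k q)_n = (V^k p)_n = 0` for all `k`: position and momentum are
orthogonal to the cyclic subspace of `V` generated by `e_n`, so that the motion never feels the
friction. Its orthogonal complement turns out to be `L₋`. -/
def undamped (V : Matrix (Fin N) (Fin N) ℝ) (n : Fin N) : Submodule ℝ (Phase N) where
  carrier := {x | ∀ k : ℕ, ((V ^ k) *ᵥ position x) n = 0 ∧ ((V ^ k) *ᵥ momentum x) n = 0}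
  zero_mem' := fun k => by
    have hq : position (0 : Phase N) = 0 := rfl
    have hp : momentum (0 : Phase N) = 0 := rfl
    simp [hq, hp]
  add_mem' := fun {x y} hx hy k => by
    have hq : position (x + y) = position x + position y := rfl
    have hp : momentum (x + y) = momentum x + momentum y := rfl
    simp [hq, hp, Matrix.mulVec_add, hx k, hy k]
  smul_mem' := fun c x hx k => by
    have hq : position (c • x) = c • position x := rfl
    have hp : momentum (c • x) = c • momentum x := rfl
    simp [hq, hp, Matrix.mulVec_smul, hx k]

theorem momentum_eq_zero_of_mem_undamped {n : Fin N} {x : Phase N} (hx : x ∈ undamped V n) :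
    momentum x n = 0 := by simpa using (hx 0).2

theorem hessian_mem_undamped {n : Fin N} {x : Phase N} (hx : x ∈ undamped V n) :
    hessian V x ∈ undamped V n := fun k => by
  refine ⟨?_, by simpa using (hx k).2⟩
  rw [position_hessian, Matrix.mulVec_mulVec, ← pow_succ]
  exact (hx (k + 1)).1

theorem reversal_mem_undamped {n : Fin N} {x : Phase N} (hx : x ∈ undamped V n) :
    reversal x ∈ undamped V n := fun k => by
  simpa [Matrix.mulVec_neg] using hx k

theorem drift_mem_undamped (α : ℝ) {n : Fin N} {x : Phase N} (hx : x ∈ undamped V n) :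
    drift V α n x ∈ undamped V n := fun k => by
  refine ⟨by simpa using (hx k).2, ?_⟩
  rw [momentum_drift, momentum_eq_zero_of_mem_undamped hx, mul_zero, zero_smul, sub_zero,
    Matrix.mulVec_neg, Matrix.mulVec_mulVec, ← pow_succ]
  simpa using (hx (k + 1)).1

theorem flow_mem_undamped (α : ℝ) {n : Fin N} (t : ℝ) {x : Phase N} (hx : x ∈ undamped V n) :
    flow V α n t x ∈ undamped V n :=
  exp_smul_apply_mem (Submodule.closed_of_finiteDimensional _)
    (fun _ => drift_mem_undamped α) t hx

theorem hessian_mem_orthogonal (hV : V.PosDef) {n : Fin N} {x : Phase N}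
    (hx : x ∈ (undamped V n)ᗮ) : hessian V x ∈ (undamped V n)ᗮ := by
  rw [Submodule.mem_orthogonal] at hx ⊢
  intro y hy
  rw [← inner_hessian_comm hV]
  exact hx _ (hessian_mem_undamped hy)

theorem reversal_mem_orthogonal {n : Fin N} {x : Phase N}
    (hx : x ∈ (undamped V n)ᗮ) : reversal x ∈ (undamped V n)ᗮ := by
  rw [Submodule.mem_orthogonal] at hx ⊢
  intro y hy
  have := hx _ (reversal_mem_undamped hy)
  simpa [inner_eq_dotProduct] using this

theorem drift_mem_orthogonal (hV : V.PosDef) (α : ℝ) {n : Fin N} {x : Phase N}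
    (hx : x ∈ (undamped V n)ᗮ) : drift V α n x ∈ (undamped V n)ᗮ := by
  rw [Submodule.mem_orthogonal] at hx ⊢
  intro y hy
  -- on the undamped space the adjoint of the drift is `(q, p) ↦ (-V p, q)`
  let z : Phase N := WithLp.toLp 2 (Sum.elim (-(V *ᵥ momentum y)) (position y))
  have hzq : position z = -(V *ᵥ momentum y) := rfl
  have hzp : momentum z = position y := rfl
  have hz : z ∈ undamped V n := fun k => by
    refine ⟨?_, by rw [hzp]; exact (hy k).1⟩
    rw [hzq, Matrix.mulVec_neg, Matrix.mulVec_mulVec, ← pow_succ]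
    simpa using (hy (k + 1)).2
  have h := hx z hz
  rw [inner_eq_dotProduct, hzq, hzp] at h
  rw [inner_eq_dotProduct, position_drift, momentum_drift, dotProduct_sub, dotProduct_neg,
    dotProduct_smul, dotProduct_single, momentum_eq_zero_of_mem_undamped hy,
    ← mulVec_dotProduct_comm hV]
  rw [neg_dotProduct] at h
  simp only [zero_mul, smul_zero, sub_zero]
  linarith

theorem flow_mem_orthogonal (hV : V.PosDef) (α : ℝ) {n : Fin N} (t : ℝ) {x : Phase N}
    (hx : x ∈ (undamped V n)ᗮ) : flow V α n t x ∈ (undamped V n)ᗮ :=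
  exp_smul_apply_mem (Submodule.isClosed_orthogonal _)
    (fun _ => drift_mem_orthogonal hV α) t hx

/-- If the damped momentum `p_n` vanishes along the whole trajectory of `x`, so do all its time
derivatives, and these are, up to sign, the numbers `(V^k p)_n` and `(V^{k+1} q)_n`. -/
theorem hessian_mem_undamped_of_momentum_flow_eq_zero {α : ℝ} {n : Fin N} {x : Phase N}
    (hx : ∀ s > 0, momentum (flow V α n s x) n = 0) : hessian V x ∈ undamped V n := by
  have h0 : ∀ z : Phase N, (∀ s > 0, momentum (flow V α n s z) n = 0) → momentum z n = 0 := by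
    intro z hz
    have h1 := ((continuous_momentum_flow V α n z).tendsto 0).mono_left
      (nhdsWithin_le_nhds (s := Set.Ioi (0 : ℝ)))
    rw [flow_zero] at h1
    refine tendsto_nhds_unique h1 (tendsto_const_nhds.congr' ?_)
    filter_upwards [self_mem_nhdsWithin] with s hs using (hz s hs).symm
  -- the hypothesis passes from `z` to `drift V α n z` by differentiation in `s`
  have hstep : ∀ z : Phase N, (∀ s > 0, momentum (flow V α n s z) n = 0) →
      ∀ s > 0, momentum (flow V α n s (drift V α n z)) n = 0 := by
    intro z hz s hs
    have h1 : HasDerivAt (fun s => flow V α n s z) (flow V α n s (drift V α n z)) s :=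
      hasDerivAt_exp_smul_apply _ z s
    have h2 : HasDerivAt (fun s => momentum (flow V α n s z) n)
        (momentum (flow V α n s (drift V α n z)) n) s :=
      (EuclideanSpace.proj (𝕜 := ℝ) (Sum.inr n : Fin N ⊕ Fin N)).hasFDerivAt.comp_hasDerivAt s h1
    refine h2.unique ((hasDerivAt_const s (0 : ℝ)).congr_of_eventuallyEq ?_)
    filter_upwards [lt_mem_nhds hs] with r hr using hz r hr
  have hmom : ∀ k : ℕ, ∀ z : Phase N, (∀ s > 0, momentum (flow V α n s z) n = 0) →
      ((V ^ k) *ᵥ momentum z) n = 0 := by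
    intro k
    induction k with
    | zero => intro z hz; simpa using h0 z hz
    | succ k ih =>
      intro z hz
      -- without friction, the momentum of the twice iterated drift is `-V p`
      have h2 := ih _ (hstep _ (hstep z hz))
      rw [momentum_drift, h0 _ (hstep z hz), mul_zero, zero_smul, sub_zero, position_drift,
        Matrix.mulVec_neg, Matrix.mulVec_mulVec, ← pow_succ] at h2
      simpa using h2
  intro k
  refine ⟨?_, by simpa using hmom k x hx⟩
  -- without friction, the momentum of the drift is `-V q`
  have h1 := hmom k _ (hstep x hx)
  rw [momentum_drift, h0 x hx, mul_zero, zero_smul, sub_zero, Matrix.mulVec_neg] at h1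
  rw [position_hessian]
  simpa using h1

theorem energy_flow_of_mem_undamped (hV : V.PosDef) (α : ℝ) {n : Fin N} (t : ℝ) {x : Phase N}
    (hx : x ∈ undamped V n) : energy V (flow V α n t x) = energy V x := by
  have h := integral_momentum_flow_sq hV α n x t
  simp only [momentum_eq_zero_of_mem_undamped (flow_mem_undamped α _ hx)] at h
  simp at h
  linarith

/-- LaSalle's argument. The energy decreases to some `L`, and any cluster point `y` of the bounded
trajectory has constant energy `L`. So the trajectory of `y` is not damped and `hessian V y` lies in
the undamped space, to which `y` is orthogonal: `2 L = ⟪hessian V y, y⟫ = 0`. -/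
theorem tendsto_energy_flow_zero (hV : V.PosDef) {α : ℝ} (hα : 0 < α) {n : Fin N} {x : Phase N}
    (hx : x ∈ (undamped V n)ᗮ) :
    Tendsto (fun t => energy V (flow V α n t x)) atTop (𝓝 0) := by
  have hanti := antitone_energy_flow hV hα.le n x
  have hbdd : BddBelow (Set.range fun t => energy V (flow V α n t x)) :=
    ⟨0, by rintro _ ⟨t, rfl⟩; exact energy_nonneg hV _⟩
  have hlim := tendsto_atTop_ciInf hanti hbdd
  set L := ⨅ t, energy V (flow V α n t x)
  suffices hL : L = 0 by rwa [hL] at hlim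
  obtain ⟨c, hc, hle⟩ := exists_mul_norm_sq_le_energy hV
  have hball : ∀ k : ℕ, flow V α n k x ∈ Metric.closedBall (0 : Phase N) (√(energy V x / c)) := by
    intro k
    rw [mem_closedBall_zero_iff]
    refine Real.le_sqrt_of_sq_le ?_
    rw [le_div_iff₀ hc, mul_comm]
    refine (hle _).trans ?_
    simpa using hanti (Nat.cast_nonneg k)
  obtain ⟨y, -, θ, hθ, hy⟩ := (isCompact_closedBall (0 : Phase N) _).tendsto_subseq hball
  have hyS : y ∈ (undamped V n)ᗮ := (Submodule.isClosed_orthogonal _).mem_of_tendsto hy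
    (Eventually.of_forall fun k => flow_mem_orthogonal hV α _ hx)
  have hcast : Tendsto (fun k => (θ k : ℝ)) atTop atTop :=
    tendsto_natCast_atTop_atTop.comp hθ.tendsto_atTop
  have hconst : ∀ s, energy V (flow V α n s y) = L := by
    intro s
    have h1 : Tendsto (fun k => energy V (flow V α n s (flow V α n (θ k) x))) atTop
        (𝓝 (energy V (flow V α n s y))) :=
      (((continuous_energy V).comp
        (NormedSpace.exp (s • drift V α n)).continuous).tendsto y).comp hy
    simp only [← flow_add] at h1
    exact tendsto_nhds_unique h1 (hlim.comp (tendsto_atTop_add_const_left _ s hcast))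
  have hmom : ∀ s, momentum (flow V α n s y) n = 0 := by
    intro s
    have h1 := hasDerivAt_energy_flow hV α n y s
    simp only [hconst] at h1
    have h2 := h1.unique (hasDerivAt_const s L)
    simpa [hα.ne'] using h2
  have h1 := hessian_mem_undamped_of_momentum_flow_eq_zero (fun s _ => hmom s)
  have h2 := (Submodule.mem_orthogonal _ _).1 hyS _ h1
  have h3 := hconst 0
  rw [flow_zero, energy_eq_inner, h2, mul_zero] at h3
  exact h3.symm

theorem LMinus_eq_orthogonal (hV : V.PosDef) {α : ℝ} (hα : 0 < α) (n : Fin N) :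
    LMinus V hV α n = (undamped V n)ᗮ := by
  apply le_antisymm
  · intro x hx
    obtain ⟨b, hb, a, ha, rfl⟩ := (undamped V n).exists_add_mem_mem_orthogonal x
    have ha' : a ∈ LMinus V hV α n := tendsto_energy_flow_zero hV hα ha
    have hb' : Tendsto (fun t => energy V (flow V α n t b)) atTop (𝓝 0) := by
      have : b ∈ LMinus V hV α n := by simpa using Submodule.sub_mem _ hx ha'
      exact this
    simp only [energy_flow_of_mem_undamped hV α _ hb] at hb'
    have hb0 := eq_zero_of_energy_eq_zero hV (tendsto_nhds_unique tendsto_const_nhds hb')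
    simpa [hb0] using ha
  · exact fun x hx => tendsto_energy_flow_zero hV hα hx

/-! ### Asymptotics of mean and variance -/

/-- The adjoint of the flow for the energy form is its conjugate by time reversal:
`⟪hessian V (flow (r - s) (reversal x)), reversal (flow s y)⟫` does not depend on `s`. -/
theorem inner_hessian_flow (hV : V.PosDef) (α : ℝ) (n : Fin N) (r : ℝ) (x y : Phase N) :
    inner ℝ (hessian V x) (flow V α n r y) =
      inner ℝ (hessian V (flow V α n r (reversal x))) (reversal y) := by
  have hd : ∀ s, HasDerivAt (fun s => inner ℝ (hessian V (flow V α n (r - s) (reversal x)))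
      (reversal (flow V α n s y))) 0 s := by
    intro s
    have h1 := (hasDerivAt_flow V α n (reversal x) (r - s)).scomp s ((hasDerivAt_id s).const_sub r)
    have h2 := ((hessian V).hasFDerivAt.comp_hasDerivAt s h1).inner ℝ
      (reversal.hasFDerivAt.comp_hasDerivAt s (hasDerivAt_flow V α n y s))
    refine h2.congr_deriv ?_
    simp [inner_hessian_drift_reversal hV]
  have h := is_const_of_deriv_eq_zero (fun s => (hd s).differentiableAt) (fun s => (hd s).deriv) r 0
  simpa [inner_hessian_reversal_reversal] using h

/-- The variance of `⟪hessian V b, ψ(t)⟫` in closed form: up to sign, the integrand is the momentum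
`p_n` of the trajectory started at the time reversal of `b`, so the energy balance evaluates the
integral. -/
theorem variance_eq_energy_sub (hV : V.PosDef) {α : ℝ} (hα : 0 < α) (n : Fin N) (σ : ℝ)
    (b : Phase N) (t : ℝ) :
    σ ^ 2 * ∫ s in (0 : ℝ)..t, inner ℝ (hessian V b) (flow V α n s (noiseDir n)) ^ 2 =
      σ ^ 2 / α * (energy V b - energy V (flow V α n t (reversal b))) := by
  have e : ∀ s, inner ℝ (hessian V b) (flow V α n s (noiseDir n)) ^ 2 =
      momentum (flow V α n s (reversal b)) n ^ 2 := fun s => by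
    have hr : reversal (noiseDir n) = -noiseDir n := phase_ext
      (by rw [position_reversal]; simp; ext i; simp [position, noiseDir])
      (by rw [momentum_reversal]; rfl)
    rw [inner_hessian_flow hV, hr, inner_neg_right, inner_hessian_noiseDir, neg_sq]
  have hb : energy V (reversal b) = energy V b := by
    rw [energy_eq_inner, energy_eq_inner, inner_hessian_reversal_reversal]
  simp only [e]
  rw [← hb, ← integral_momentum_flow_sq hV α n (reversal b) t]
  field_simp

theorem tendsto_variance (hV : V.PosDef) {α : ℝ} (hα : 0 < α) {n : Fin N} (σ : ℝ) {b : Phase N}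
    (hb : b ∈ LMinus V hV α n) :
    Tendsto (fun t : ℝ => σ ^ 2 *
      ∫ s in (0 : ℝ)..t, inner ℝ (hessian V b) (flow V α n s (noiseDir n)) ^ 2) atTop
      (𝓝 (σ ^ 2 / α * energy V b)) := by
  simp only [variance_eq_energy_sub hV hα]
  rw [LMinus_eq_orthogonal hV hα] at hb
  simpa using ((tendsto_energy_flow_zero hV hα (reversal_mem_orthogonal hb)).const_sub
    (energy V b)).const_mul (σ ^ 2 / α)

theorem tendsto_inner_flow_zero (hV : V.PosDef) {α : ℝ} (hα : 0 < α) {n : Fin N} {u : Phase N}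
    (hu : u ∈ LMinus V hV α n) (x : Phase N) :
    Tendsto (fun t => inner ℝ u (flow V α n t x)) atTop (𝓝 0) := by
  -- the undamped part of `x` stays orthogonal to `u`, and the rest decays
  obtain ⟨b, hb, a, ha, rfl⟩ := (undamped V n).exists_add_mem_mem_orthogonal x
  have h1 := tendsto_zero_of_energy_tendsto_zero hV (tendsto_energy_flow_zero hV hα ha)
  rw [LMinus_eq_orthogonal hV hα] at hu
  have e : ∀ t, inner ℝ u (flow V α n t (b + a)) = inner ℝ u (flow V α n t a) := fun t => by
    have : flow V α n t (b + a) = flow V α n t b + flow V α n t a := map_add _ b a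
    rw [this, inner_add_right, (Submodule.mem_orthogonal' _ _).1 hu _ (flow_mem_undamped α t hb),
      zero_add]
  simp only [e]
  simpa using tendsto_const_nhds.inner (𝕜 := ℝ) h1

theorem hessian_mem_LMinus (hV : V.PosDef) {α : ℝ} (hα : 0 < α) {n : Fin N} {b : Phase N}
    (hb : b ∈ LMinus V hV α n) : hessian V b ∈ LMinus V hV α n := by
  rw [LMinus_eq_orthogonal hV hα] at hb ⊢
  exact hessian_mem_orthogonal hV hb

/-- Every vector of `L₋` represents, for the Euclidean product, the functional which some `b ∈ L₋`
represents for the energy form. -/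
theorem exists_hessian_eq (hV : V.PosDef) {α : ℝ} (hα : 0 < α) {n : Fin N} {u : Phase N}
    (hu : u ∈ LMinus V hV α n) : ∃ b ∈ LMinus V hV α n, hessian V b = u := by
  let T : LMinus V hV α n →ₗ[ℝ] LMinus V hV α n :=
    (hessian V : Phase N →ₗ[ℝ] Phase N).restrict fun _ => hessian_mem_LMinus hV hα
  have hT : Function.Injective T := by
    rw [injective_iff_map_eq_zero]
    intro x hx
    have hx' : hessian V (x : Phase N) = 0 := congrArg Subtype.val hx
    have := eq_zero_of_energy_eq_zero hV (x := (x : Phase N))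
      (by rw [energy_eq_inner, hx', inner_zero_left, mul_zero])
    exact Subtype.ext this
  obtain ⟨b, hb⟩ := LinearMap.injective_iff_surjective.1 hT ⟨u, hu⟩
  exact ⟨b, b.2, congrArg Subtype.val hb⟩

/-! ### Gaussian measures defined by a quadratic form -/

/-- A positive definite symmetric bilinear form becomes the Euclidean product in suitable
coordinates. -/
theorem exists_equiv_euclideanSpace {W : Type*} [NormedAddCommGroup W] [NormedSpace ℝ W]
    [FiniteDimensional ℝ W] (B : LinearMap.BilinForm ℝ W) (hs : B.IsSymm)
    (hp : ∀ x ≠ 0, 0 < B x x) :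
    ∃ e : W ≃L[ℝ] EuclideanSpace ℝ (Fin (Module.finrank ℝ W)),
      ∀ x y, B x y = inner ℝ (e x) (e y) := by
  let _ : Invertible (2 : ℝ) := invertibleOfNonzero two_ne_zero
  obtain ⟨v, hv⟩ := LinearMap.BilinForm.exists_orthogonal_basis (B := B)
    (LinearMap.BilinForm.isSymm_iff.1 hs)
  have hpos : ∀ i, 0 < B (v i) (v i) := fun i => hp _ (v.ne_zero i)
  obtain ⟨b, hb⟩ : ∃ b : Module.Basis (Fin (Module.finrank ℝ W)) ℝ W,
      ∀ i j, B (b i) (b j) = if i = j then 1 else 0 := by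
    refine ⟨v.isUnitSMul (w := fun i => (√(B (v i) (v i)))⁻¹) fun i =>
      isUnit_iff_ne_zero.2 (inv_ne_zero (Real.sqrt_pos.2 (hpos i)).ne'), fun i j => ?_⟩
    simp only [Module.Basis.isUnitSMul_apply, map_smul, LinearMap.smul_apply, smul_eq_mul]
    split_ifs with h
    · subst h
      rw [← mul_assoc, ← mul_inv, Real.mul_self_sqrt (hpos i).le, inv_mul_cancel₀ (hpos i).ne']
    · rw [show B (v i) (v j) = 0 from hv h, mul_zero, mul_zero]
  refine ⟨b.equivFun.toContinuousLinearEquiv.trans (EuclideanSpace.equiv _ ℝ).symm, fun x y => ?_⟩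
  have hxy : B x y = ∑ i, b.repr x i * b.repr y i := by
    conv_lhs => rw [← b.sum_repr x, ← b.sum_repr y]
    simp only [map_sum, LinearMap.sum_apply, map_smul, LinearMap.smul_apply, smul_eq_mul, hb,
      mul_ite, mul_one, mul_zero, Finset.sum_ite_eq', Finset.mem_univ, if_true]
    exact Finset.sum_congr rfl fun i _ => mul_comm _ _
  rw [hxy]
  simp [PiLp.inner_apply, mul_comm]

section Gaussian

variable {W : Type*} [NormedAddCommGroup W] [NormedSpace ℝ W]
  [MeasurableSpace W] [BorelSpace W] (μ : Measure W) [μ.IsAddHaarMeasure] {d : ℕ}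
  (e : W ≃L[ℝ] EuclideanSpace ℝ (Fin d)) {β : ℝ}

theorem exists_map_addHaar_eq_smul_volume : ∃ c : ℝ≥0, μ.map e = c • volume :=
  ⟨_, Measure.isAddLeftInvariant_eq_smul (μ.map e) (volume : Measure (EuclideanSpace ℝ (Fin d)))⟩

/-- The Fourier transform of a Gaussian for an arbitrary Haar measure, whose normalization
cancels. -/
theorem integral_cexp_quadratic (hβ : 0 < β) (y : EuclideanSpace ℝ (Fin d)) :
    ∫ x, Complex.exp (-β * ‖e x‖ ^ 2 + Complex.I * inner ℝ y (e x)) ∂μ =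
      (∫ x, Complex.exp (-β * ‖e x‖ ^ 2) ∂μ) * Complex.exp (-‖y‖ ^ 2 / (4 * β)) := by
  obtain ⟨c, hc⟩ := exists_map_addHaar_eq_smul_volume μ e
  have hemb : MeasurableEmbedding e := e.toHomeomorph.measurableEmbedding
  have hβ' : 0 < (β : ℂ).re := by simpa using hβ
  rw [← hemb.integral_map (fun z : EuclideanSpace ℝ (Fin d) =>
      Complex.exp (-β * ‖z‖ ^ 2 + Complex.I * inner ℝ y z)),
    ← hemb.integral_map (fun z : EuclideanSpace ℝ (Fin d) => Complex.exp (-β * ‖z‖ ^ 2)), hc,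
    integral_smul_nnreal_measure, integral_smul_nnreal_measure,
    GaussianFourier.integral_cexp_neg_mul_sq_norm_add hβ',
    GaussianFourier.integral_cexp_neg_mul_sq_norm hβ', smul_mul_assoc]
  simp

theorem integrable_rexp_quadratic (hβ : 0 < β) :
    Integrable (fun x => Real.exp (-β * ‖e x‖ ^ 2)) μ := by
  obtain ⟨c, hc⟩ := exists_map_addHaar_eq_smul_volume μ e
  have hemb : MeasurableEmbedding e := e.toHomeomorph.measurableEmbedding
  have hβ' : 0 < (β : ℂ).re := by simpa using hβ
  have h : Integrable (fun z : EuclideanSpace ℝ (Fin d) => Real.exp (-β * ‖z‖ ^ 2)) (μ.map e) := by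
    rw [hc]
    refine Integrable.smul_measure_nnreal ?_
    have := (GaussianFourier.integrable_cexp_neg_mul_sq_norm_add hβ' 0
      (0 : EuclideanSpace ℝ (Fin d))).re
    refine this.congr (ae_of_all _ fun z => ?_)
    have : (-(β : ℂ) * (‖z‖ : ℂ) ^ 2 + 0 * ((inner ℝ (0 : EuclideanSpace ℝ (Fin d)) z : ℝ) : ℂ)) =
      ((-β * ‖z‖ ^ 2 : ℝ) : ℂ) := by push_cast; ring
    simp only [this, ← Complex.ofReal_exp]
    rfl
  exact (hemb.integrable_map_iff).1 h

theorem isProbabilityMeasure_withDensity_quadratic (hβ : 0 < β) :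
    IsProbabilityMeasure (μ.withDensity fun x => ENNReal.ofReal
      (1 / (∫ x, Real.exp (-β * ‖e x‖ ^ 2) ∂μ) * Real.exp (-β * ‖e x‖ ^ 2))) := by
  have hint := integrable_rexp_quadratic μ e hβ
  have hZ : 0 < ∫ x, Real.exp (-β * ‖e x‖ ^ 2) ∂μ := integral_exp_pos hint
  constructor
  rw [withDensity_apply _ MeasurableSet.univ, Measure.restrict_univ,
    ← ofReal_integral_eq_lintegral_ofReal (hint.const_mul _) (ae_of_all _ fun x => by positivity),
    integral_const_mul, one_div, inv_mul_cancel₀ hZ.ne', ENNReal.ofReal_one]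

theorem integral_cexp_withDensity_quadratic (hβ : 0 < β) (y : EuclideanSpace ℝ (Fin d)) :
    ∫ x, Complex.exp (Complex.I * inner ℝ y (e x)) ∂(μ.withDensity fun x => ENNReal.ofReal
      (1 / (∫ x, Real.exp (-β * ‖e x‖ ^ 2) ∂μ) * Real.exp (-β * ‖e x‖ ^ 2))) =
      Complex.exp (-‖y‖ ^ 2 / (4 * β)) := by
  have hint := integrable_rexp_quadratic μ e hβ
  have hZ : 0 < ∫ x, Real.exp (-β * ‖e x‖ ^ 2) ∂μ := integral_exp_pos hint
  set Z := ∫ x, Real.exp (-β * ‖e x‖ ^ 2) ∂μ with hZdef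
  have hZc : ∫ x, Complex.exp (-β * ‖e x‖ ^ 2) ∂μ = (Z : ℂ) := by
    rw [hZdef, ← integral_complex_ofReal]
    push_cast
    rfl
  rw [integral_withDensity_eq_integral_toReal_smul (by fun_prop)
    (ae_of_all _ fun x => ENNReal.ofReal_lt_top)]
  have hZ0 : (Z : ℂ) ≠ 0 := by exact_mod_cast hZ.ne'
  have e1 : ∀ x, (ENNReal.ofReal (1 / Z * Real.exp (-β * ‖e x‖ ^ 2))).toReal •
      Complex.exp (Complex.I * inner ℝ y (e x)) =
      (Z : ℂ)⁻¹ * Complex.exp (-β * ‖e x‖ ^ 2 + Complex.I * inner ℝ y (e x)) := fun x => by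
    rw [ENNReal.toReal_ofReal (by positivity), Complex.exp_add, Complex.real_smul]
    push_cast
    ring
  simp only [e1]
  rw [integral_const_mul, integral_cexp_quadratic μ e hβ, hZc, ← mul_assoc, inv_mul_cancel₀ hZ0,
    one_mul]

end Gaussian

/-! ### The Gibbs measure -/

/-- Coordinates on `L₋` in which the energy is half the squared Euclidean norm. -/
theorem exists_equiv_LMinus (hV : V.PosDef) (α : ℝ) (n : Fin N) :
    ∃ e : LMinus V hV α n ≃L[ℝ] EuclideanSpace ℝ (Fin (Module.finrank ℝ (LMinus V hV α n))),
      ∀ x y : LMinus V hV α n, inner ℝ (hessian V x) (y : Phase N) = inner ℝ (e x) (e y) := by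
  let B : LinearMap.BilinForm ℝ (LMinus V hV α n) :=
    (innerₗ (Phase N)).compl₁₂ ((hessian V : Phase N →ₗ[ℝ] Phase N) ∘ₗ Submodule.subtype _)
      (Submodule.subtype _)
  have hB : ∀ x y, B x y = inner ℝ (hessian V x) (y : Phase N) := fun x y => rfl
  obtain ⟨e, he⟩ := exists_equiv_euclideanSpace B
    ⟨fun x y => by rw [hB, hB, inner_hessian_comm hV, real_inner_comm]⟩ fun x hx => by
      have h1 := energy_nonneg hV (x : Phase N)
      have h2 : energy V (x : Phase N) ≠ 0 := fun h =>
        hx (Subtype.ext (eq_zero_of_energy_eq_zero hV h))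
      have h3 := h1.lt_of_ne' h2
      rw [energy_eq_inner] at h3
      rw [hB]
      linarith
  exact ⟨e, fun x y => by rw [← he, hB]⟩

theorem gibbs_eq_withDensity (hV : V.PosDef) (α σ : ℝ) (n : Fin N) (Z : ℝ) {d : ℕ}
    (e : LMinus V hV α n ≃L[ℝ] EuclideanSpace ℝ (Fin d))
    (he : ∀ x y : LMinus V hV α n, inner ℝ (hessian V x) (y : Phase N) = inner ℝ (e x) (e y)) :
    gibbs V hV α σ n Z = (lebesgue (LMinus V hV α n)).withDensity fun x =>
      ENNReal.ofReal (1 / Z * Real.exp (-(α / σ ^ 2) * ‖e x‖ ^ 2)) := by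
  unfold gibbs
  congr 1
  ext x
  rw [energy_eq_inner, he, real_inner_self_eq_norm_sq]
  congr 3
  ring

theorem isAddHaarMeasure_lebesgue (S : Submodule ℝ (Phase N)) : (lebesgue S).IsAddHaarMeasure := by
  unfold lebesgue
  infer_instance

/-- The Gibbs measure for the normalizing `Z`, and its characteristic function at `u = hessian V b`:
Gaussian, with `⟪u, ·⟫` of variance `(σ² / α) H(b)`, the limit found in `tendsto_variance`. The
vanishing mean is kept in the formula to match `IsSolution.charFun_minusPart`. -/
theorem exists_isProbabilityMeasure_gibbs (hV : V.PosDef) {α σ : ℝ} (hα : 0 < α) (hσ : 0 < σ)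
    (n : Fin N) : ∃ Z : ℝ, 0 < Z ∧ IsProbabilityMeasure (gibbs V hV α σ n Z) ∧
      ∀ u b : LMinus V hV α n, hessian V b = u → charFun (gibbs V hV α σ n Z) u =
        Complex.exp (((0 : ℝ) : ℂ) * Complex.I - (σ ^ 2 / α * energy V b : ℝ) / 2) := by
  obtain ⟨e, he⟩ := exists_equiv_LMinus hV α n
  have hβ : 0 < α / σ ^ 2 := by positivity
  have := isAddHaarMeasure_lebesgue (LMinus V hV α n)
  refine ⟨_, integral_exp_pos (integrable_rexp_quadratic (lebesgue (LMinus V hV α n)) e hβ),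
    ?_, fun u b hbu => ?_⟩
  · rw [gibbs_eq_withDensity hV α σ n _ e he]
    exact isProbabilityMeasure_withDensity_quadratic _ e hβ
  rw [gibbs_eq_withDensity hV α σ n _ e he, charFun_apply]
  have hinner : ∀ x : LMinus V hV α n, inner ℝ x u = inner ℝ (e b) (e x) := fun x => by
    rw [← he, real_inner_comm, hbu, Submodule.coe_inner]
  simp only [hinner, mul_comm _ Complex.I]
  rw [integral_cexp_withDensity_quadratic _ e hβ]
  congr 1
  have h1 : ‖e b‖ ^ 2 = 2 * energy V b := by
    rw [← real_inner_self_eq_norm_sq, ← he, energy_eq_inner]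
    ring
  have h2 : -‖e b‖ ^ 2 / (4 * (α / σ ^ 2)) = -(σ ^ 2 / α * energy V b) / 2 := by
    rw [h1]
    field_simp
    ring
  have h3 := congrArg (fun r : ℝ => (r : ℂ)) h2
  push_cast at h3 ⊢
  rw [h3]
  ring

/-! ### The law of the component in `L₋` -/

theorem inner_minusPart (hV : V.PosDef) (α : ℝ) (n : Fin N) {u : Phase N}
    (hu : u ∈ LMinus V hV α n) (x : Phase N) :
    inner ℝ u (minusPart V hV α n x : Phase N) = inner ℝ u x := by
  have := (LMinus V hV α n).inner_orthogonalProjectionOnto_eq_of_mem_left ⟨u, hu⟩ x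
  exact this

theorem continuous_minusPart (hV : V.PosDef) (α : ℝ) (n : Fin N) :
    Continuous (minusPart V hV α n) :=
  (LMinus V hV α n).orthogonalProjectionOnto.continuous

theorem IsSolution.aemeasurable_minusPart {Ω : Type*} [MeasurableSpace Ω] {P : Measure Ω}
    {w : ℝ≥0 → Ω → ℝ} {α σ : ℝ} {n : Fin N} {ψ₀ : Phase N} {ψ : ℝ≥0 → Ω → Phase N}
    (hψ : IsSolution P V α σ n w ψ₀ ψ) (hV : V.PosDef)
    (t : ℝ≥0) : AEMeasurable (fun ω => minusPart V hV α n (ψ t ω)) P :=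
  (continuous_minusPart hV α n).measurable.comp_aemeasurable (hψ.aemeasurable t)

section Law

variable {Ω : Type*} [MeasurableSpace Ω] {P : Measure Ω} [IsProbabilityMeasure P]
  {w : ℝ≥0 → Ω → ℝ} {α σ : ℝ} {n : Fin N} {ψ₀ : Phase N} {ψ : ℝ≥0 → Ω → Phase N}

theorem IsSolution.hasLaw_inner (hψ : IsSolution P V α σ n w ψ₀ ψ) (hw : IsBrownianReal w P)
    (u : Phase N) (t : ℝ≥0) :
    HasLaw (fun ω => inner ℝ u (ψ t ω)) (gaussianReal (inner ℝ u (flow V α n t ψ₀))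
      (σ ^ 2 * ∫ s in (0 : ℝ)..t, inner ℝ u (flow V α n s (noiseDir n)) ^ 2).toNNReal) P :=
  hasLaw_inner_of_integral_equation hw (drift V α n) (noiseDir n) ψ₀ σ hψ.continuous_paths
    hψ.equation u t

theorem variance_nonneg (u : Phase N) (t : ℝ≥0) :
    0 ≤ σ ^ 2 * ∫ s in (0 : ℝ)..t, inner ℝ u (flow V α n s (noiseDir n)) ^ 2 :=
  mul_nonneg (sq_nonneg _) (intervalIntegral.integral_nonneg t.2 fun _ _ => sq_nonneg _)

theorem IsSolution.charFun_minusPart (hψ : IsSolution P V α σ n w ψ₀ ψ)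
    (hw : IsBrownianReal w P) (hV : V.PosDef) (t : ℝ≥0) (u : LMinus V hV α n) :
    charFun (P.map fun ω => minusPart V hV α n (ψ t ω)) u =
      Complex.exp ((inner ℝ (u : Phase N) (flow V α n t ψ₀) : ℝ) * Complex.I -
        (σ ^ 2 * ∫ s in (0 : ℝ)..t,
          inner ℝ (u : Phase N) (flow V α n s (noiseDir n)) ^ 2 : ℝ) / 2) := by
  have hl := hψ.hasLaw_inner hw (u : Phase N) t
  have h1 := charFun_gaussianReal (μ := inner ℝ (u : Phase N) (flow V α n t ψ₀))
    (v := (σ ^ 2 * ∫ s in (0 : ℝ)..t,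
      inner ℝ (u : Phase N) (flow V α n s (noiseDir n)) ^ 2).toNNReal) 1
  rw [← hl.map_eq, charFun_apply_real, integral_map hl.aemeasurable (by fun_prop),
    Real.coe_toNNReal _ (variance_nonneg (u : Phase N) t)] at h1
  rw [charFun_apply, integral_map (hψ.aemeasurable_minusPart hV t) (by fun_prop)]
  have e : ∀ ω, inner ℝ (minusPart V hV α n (ψ t ω)) u = inner ℝ (u : Phase N) (ψ t ω) :=
    fun ω => by
      rw [real_inner_comm]
      exact inner_minusPart hV α n u.2 _
  simp only [e]
  simpa using h1

theorem IsSolution.tendsto_charFun_minusPart (hψ : IsSolution P V α σ n w ψ₀ ψ)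
    (hw : IsBrownianReal w P) (hV : V.PosDef) (hα : 0 < α) (u b : LMinus V hV α n) (hbu : hessian V b = u) :
    Tendsto (fun t => charFun (P.map fun ω => minusPart V hV α n (ψ t ω)) u) atTop
      (𝓝 (Complex.exp (((0 : ℝ) : ℂ) * Complex.I - (σ ^ 2 / α * energy V b : ℝ) / 2))) := by
  have hm := (tendsto_inner_flow_zero hV hα u.2 ψ₀).comp (NNReal.tendsto_coe_atTop.2 tendsto_id)
  have hv := (tendsto_variance hV hα σ b.2).comp (NNReal.tendsto_coe_atTop.2 tendsto_id)
  rw [hbu] at hv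
  have hc : Continuous fun p : ℝ × ℝ => Complex.exp (p.1 * Complex.I - p.2 / 2) := by fun_prop
  have h := (hc.tendsto _).comp (hm.prodMk_nhds hv)
  refine h.congr fun t => ?_
  rw [hψ.charFun_minusPart hw hV]
  rfl

theorem IsSolution.tendstoInDistribution_minusPart (hψ : IsSolution P V α σ n w ψ₀ ψ)
    (hw : IsBrownianReal w P) (hV : V.PosDef) (hα : 0 < α) {ν : Measure (LMinus V hV α n)} [IsProbabilityMeasure ν]
    (hν : ∀ u b : LMinus V hV α n, hessian V b = u → charFun ν u =
        Complex.exp (((0 : ℝ) : ℂ) * Complex.I - (σ ^ 2 / α * energy V b : ℝ) / 2)) :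
    TendstoInDistribution (fun (t : ℝ≥0) ω => minusPart V hV α n (ψ t ω)) atTop id
      (fun _ => P) ν := by
  refine ⟨hψ.aemeasurable_minusPart hV, aemeasurable_id, ?_⟩
  refine tendsto_of_seq_tendsto fun θ hθ => ?_
  refine ProbabilityMeasure.tendsto_of_tendsto_charFun fun u => ?_
  change Tendsto (fun k => charFun (P.map fun ω => minusPart V hV α n (ψ (θ k) ω)) u) atTop
    (𝓝 (charFun (ν.map id) u))
  obtain ⟨b, hb, hbu⟩ := exists_hessian_eq hV hα u.2
  rw [Measure.map_id, hν u ⟨b, hb⟩ hbu]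
  exact (hψ.tendsto_charFun_minusPart hw hV hα u ⟨b, hb⟩ hbu).comp hθ

/-- In coordinates of `L₋` orthonormal for the energy form, the energy is half the sum of `dim L₋`
squared Gaussian coordinates, each with variance tending to `σ² / (2 α)` and mean tending to `0`. -/
theorem IsSolution.integrable_energy_and_tendsto (hψ : IsSolution P V α σ n w ψ₀ ψ)
    (hw : IsBrownianReal w P) (hV : V.PosDef) (hα : 0 < α) :
    (∀ t : ℝ≥0, Integrable (fun ω => energy V (minusPart V hV α n (ψ t ω) : Phase N)) P) ∧
    Tendsto (fun t : ℝ≥0 => ∫ ω, energy V (minusPart V hV α n (ψ t ω) : Phase N) ∂P) atTop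
      (𝓝 (σ ^ 2 / (4 * α) * (Module.finrank ℝ (LMinus V hV α n) : ℝ))) := by
  obtain ⟨e, he⟩ := exists_equiv_LMinus hV α n
  let b : Fin (Module.finrank ℝ (LMinus V hV α n)) → LMinus V hV α n := fun i =>
    e.symm (EuclideanSpace.single i 1)
  have hb : ∀ i, energy V (b i : Phase N) = 1 / 2 := fun i => by
    rw [energy_eq_inner, he]
    simp [b]
  have hmem : ∀ i, hessian V (b i) ∈ LMinus V hV α n := fun i => hessian_mem_LMinus hV hα (b i).2
  have henergy : ∀ x : Phase N, energy V (minusPart V hV α n x : Phase N) =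
      ∑ i, 1 / 2 * inner ℝ (hessian V (b i)) x ^ 2 := fun x => by
    rw [energy_eq_inner, he, real_inner_self_eq_norm_sq, EuclideanSpace.real_norm_sq_eq,
      Finset.mul_sum]
    refine Finset.sum_congr rfl fun i _ => ?_
    rw [← inner_minusPart hV α n (hmem i) x, he]
    simp [b, EuclideanSpace.inner_single_left]
  have hsq := fun (i : Fin _) (t : ℝ≥0) =>
    integral_sq_of_hasLaw_gaussianReal (hψ.hasLaw_inner hw (hessian V (b i)) t)
  simp only [henergy]
  refine ⟨fun t => integrable_finsetSum _ fun i _ => (hsq i t).1.const_mul _, ?_⟩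
  have hE : ∀ t : ℝ≥0, ∫ ω, ∑ i, 1 / 2 * inner ℝ (hessian V (b i)) (ψ t ω) ^ 2 ∂P =
      ∑ i, 1 / 2 * (σ ^ 2 * (∫ s in (0 : ℝ)..t,
        inner ℝ (hessian V (b i)) (flow V α n s (noiseDir n)) ^ 2) +
        inner ℝ (hessian V (b i)) (flow V α n t ψ₀) ^ 2) := fun t => by
    rw [integral_finsetSum _ fun i _ => (hsq i t).1.const_mul _]
    refine Finset.sum_congr rfl fun i _ => ?_
    rw [integral_const_mul, (hsq i t).2, Real.coe_toNNReal _ (variance_nonneg _ t)]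
  simp only [hE]
  have hlim : σ ^ 2 / (4 * α) * (Module.finrank ℝ (LMinus V hV α n) : ℝ) =
      ∑ i, 1 / 2 * (σ ^ 2 / α * energy V (b i : Phase N) + 0 ^ 2) := by
    simp only [hb, Finset.sum_const, Finset.card_univ, Fintype.card_fin, nsmul_eq_mul]
    field_simp
    ring
  rw [hlim]
  refine tendsto_finsetSum _ fun i _ => Tendsto.const_mul _ (Tendsto.add ?_ (Tendsto.pow ?_ 2))
  · exact (tendsto_variance hV hα σ (b i).2).comp (NNReal.tendsto_coe_atTop.2 tendsto_id)
  · exact (tendsto_inner_flow_zero hV hα (hmem i) ψ₀).comp (NNReal.tendsto_coe_atTop.2 tendsto_id)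

end Law

end DissipativeHamiltonian

theorem theorem1 {N : ℕ} (V : Matrix (Fin N) (Fin N) ℝ) (hV : V.PosDef) (n : Fin N)
    (α σ : ℝ) (hα : 0 < α) (hσ : 0 < σ)
    {Ω : Type*} [MeasurableSpace Ω] (P : Measure Ω) [IsProbabilityMeasure P]
    (w : ℝ≥0 → Ω → ℝ) (hw : IsBrownianReal w P)
    (ψ₀ : DissipativeHamiltonian.Phase N) (ψ : ℝ≥0 → Ω → DissipativeHamiltonian.Phase N)
    (hψ : DissipativeHamiltonian.IsSolution P V α σ n w ψ₀ ψ) :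
    (∃ Z : ℝ, 0 < Z ∧
      ∃ _ : IsProbabilityMeasure (DissipativeHamiltonian.gibbs V hV α σ n Z),
        TendstoInDistribution
          (fun (t : ℝ≥0) ω => DissipativeHamiltonian.minusPart V hV α n (ψ t ω)) atTop id
          (fun _ => P) (DissipativeHamiltonian.gibbs V hV α σ n Z)) ∧
    (∀ t : ℝ≥0, Integrable (fun ω => DissipativeHamiltonian.energy V
      (DissipativeHamiltonian.minusPart V hV α n (ψ t ω) : DissipativeHamiltonian.Phase N)) P) ∧
    Tendsto (fun t : ℝ≥0 => ∫ ω, DissipativeHamiltonian.energy V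
        (DissipativeHamiltonian.minusPart V hV α n (ψ t ω) : DissipativeHamiltonian.Phase N) ∂P)
      atTop
      (𝓝 (σ ^ 2 / (4 * α) * (Module.finrank ℝ (DissipativeHamiltonian.LMinus V hV α n) : ℝ))) := by
  obtain ⟨Z, hZ, hprob, hchar⟩ :=
    DissipativeHamiltonian.exists_isProbabilityMeasure_gibbs hV hα hσ n
  exact ⟨⟨Z, hZ, hprob, hψ.tendstoInDistribution_minusPart hw hV hα hchar⟩,
    hψ.integrable_energy_and_tendsto hw hV hα⟩
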